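/- Let $m\ge 3$, $q=2^m$, let $F=\mathbb F_q$ and let $K=\mathbb F_{q^2}$ be its quadratic extension. Write $\bar x=x^q$ for $x\in K$, $S=\{u\in K: u\bar u=1\}$, $\langle x,y\rangle=x\bar y+\bar x y\in F$, and let $\mathrm{tr}:F\to\mathbb F_2$ and $\mathrm{Tr}:K\to\mathbb F_2$ be the absolute traces. A function $f:K\to\mathbb F_2$ is bent if $\sum_{x\in K}(-1)^{f(x)+\mathrm{tr}\langle b,x\rangle}=\pm 2^m$ for every $b\in K$. A Niho bent function is a bent function that is $\mathbb F_2$-linear on $uF$ for every $u\in S$; equivalently, it is a bent function of the form $f(\lambda u)=\mathrm{tr}(\lambda g(u))$ ($\lambda\in F$, $u\in S$) for a (unique) function $g:S\to F$. Represent the points of $PG(2,q)$ as classes $(x:z)$ of nonzero pairs $(x,z)\in K\times F$ up to multiplication by $F^*$. A Niho bent function $f$ with function $g$ is associated with a hyperoval $\mathcal H$ of $PG(2,q)$ if the set $\{(u:g(u)): u\in S\}\cup\{(0:1)\}$ is projectively equivalent to $\mathcal H$, that is, is mapped onto it by a collineation induced by a semilinear bijection $K\times F\to F^3$. The hyperconic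 is the hyperoval $\{(t:t^2:1): t\in F\}\cup\{(0:1:0),(1:0:0)\}$. Two functions $f,f':K\to\mathbb F_2$ are equivalent (extended-affine equivalent) if $f'=f\circ L+\ell$ for some $\mathbb F_2$-affine permutation $L$ of $K$ and some $\mathbb F_2$-affine function $\ell:K\to\mathbb F_2$. Let $a\in K$ with $a+\bar a=1$, and put $$f_1(x)=\mathrm{Tr}\big(a x^{2^m+1}\big),\qquad f_{m-1}(x)=\mathrm{Tr}\Big(a x^{2^m+1}+\sum_{i=1}^{2^{m-2}-1}x^{d_i}\Big),$$ where $d_i$ is a positive integer with $2^{m-1}d_i\equiv(2^m-1)i+2^{m-1}\pmod{2^{2m}-1}$. Theorem. There are exactly two equivalence classes of Niho bent functions $K\to\mathbb F_2$ associated with the hyperconic. The functions $f_1$ and $f_{m-1}$ are Niho bent functions associated with the hyperconic and represent these two classes. They are given by $f_1(\lambda u)=\mathrm{tr}(\lambda g_1(u))$ and $f_{m-1}(\lambda u)=\mathrm{tr}(\lambda g_{m-1}(u))$ for $\lambda\in F$, $u\in S$, where $g_1(u)=1$ for all $u\in S$, and $g_{m-1}(u)=\frac{1}{u+\bar u}+u+\bar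 u$ for $u\in S\setminus\{1\}$, $g_{m-1}(1)=1$. -/

import Mathlib

open scoped LinearAlgebra.Projectivization

noncomputable section

namespace Niho

/-! Throughout, `F` is the field of order `q` and `K` its quadratic extension. -/

section Fields

/-- The conjugate `x̄ = x ^ q` of `x : K` over `F`, where `q = |F|`. -/
def conj (F : Type*) {K : Type*} [Field F] [Fintype F] [Field K] (x : K) : K :=
  x ^ Fintype.card F

/-- The unit circle `S = {u ∈ K : u ū = 1}`. -/
def unitCircle (F K : Type*) [Field F] [Fintype F] [Field K] : Set K :=
  {u | u * conj F u = 1}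

/-- The alternating form `⟨x, y⟩ = T(x ȳ)`, with values in `F`; `T` is the trace of `K / F`. -/
def form (F : Type*) {K : Type*} [Field F] [Fintype F] [Field K] [Algebra F K] (x y : K) : F :=
  Algebra.trace F K (x * conj F y)

theorem unitCircle_ne_zero {F K : Type*} [Field F] [Fintype F] [Field K]
    (u : unitCircle F K) : (u : K) ≠ 0 := by
  intro h
  have hu : (u : K) * conj F (u : K) = 1 := u.2
  rw [h, zero_mul] at hu
  exact zero_ne_one hu

end Fields

section Bent

/-- The Walsh transform `W_f(b) = ∑ₓ (-1) ^ (f x + b · x)` with respect to the scalar product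
`b · x = tr ⟨b, x⟩`; here `tr` is the absolute trace of `F`. -/
def walsh (F : Type*) {K : Type*} [Field F] [Fintype F] [Field K] [Fintype K] [Algebra F K]
    [Algebra (ZMod 2) F] (f : K → ZMod 2) (b : K) : ℤ :=
  ∑ x : K, (-1 : ℤ) ^ (f x + Algebra.trace (ZMod 2) F (form F b x)).val

/-- `f` is bent: `W_f(b) = ± 2 ^ (n / 2)` for all `b`. As `|K| = 2 ^ n = |F| ^ 2`, the number
`2 ^ (n / 2)` is `|F|`. -/
def IsBent (F : Type*) {K : Type*} [Field F] [Fintype F] [Field K] [Fintype K] [Algebra F K]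
    [Algebra (ZMod 2) F] (f : K → ZMod 2) : Prop :=
  ∀ b : K, walsh F f b = (Fintype.card F : ℤ) ∨ walsh F f b = -(Fintype.card F : ℤ)

/-- A Niho bent function: a bent function that is `𝔽₂`-linear on each element `uF`, `u ∈ S`, of
the Desarguesian spread of `K`. -/
def IsNihoBent (F : Type*) {K : Type*} [Field F] [Fintype F] [Field K] [Fintype K] [Algebra F K]
    [Algebra (ZMod 2) F] (f : K → ZMod 2) : Prop :=
  IsBent F f ∧
    ∀ u ∈ unitCircle F K, ∃ l : F →ₗ[ZMod 2] ZMod 2, ∀ c : F, f (algebraMap F K c * u) = l c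

/-- `f` is given by `g : S → F`, that is `f (λ u) = tr (λ g(u))` for all `λ ∈ F`, `u ∈ S`. -/
def IsGivenBy {F K : Type*} [Field F] [Fintype F] [Field K] [Algebra F K]
    [Algebra (ZMod 2) F] (f : K → ZMod 2) (g : unitCircle F K → F) : Prop :=
  ∀ (c : F) (u : unitCircle F K),
    f (algebraMap F K c * (u : K)) = Algebra.trace (ZMod 2) F (c * g u)

/-- Extended-affine equivalence of Boolean functions: `f' = f ∘ L + l` with `L` an affine
permutation and `l` an affine function. -/
def EAEquiv {V : Type*} [AddCommGroup V] [Module (ZMod 2) V] (f f' : V → ZMod 2) : Prop :=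
  ∃ (L : V ≃ᵃ[ZMod 2] V) (l : V →ᵃ[ZMod 2] ZMod 2), ∀ x, f' x = f (L x) + l x

theorem EAEquiv.equivalence {V : Type*} [AddCommGroup V] [Module (ZMod 2) V] :
    Equivalence (EAEquiv (V := V)) where
  refl f := ⟨AffineEquiv.refl _ _, 0, fun x => by simp⟩
  symm := by
    rintro f f' ⟨L, l, h⟩
    refine ⟨L.symm, -(l.comp L.symm.toAffineMap), fun x => ?_⟩
    rw [h]
    simp [add_assoc, CharTwo.add_self_eq_zero]
  trans := by
    rintro f f' f'' ⟨L, l, h⟩ ⟨L', l', h'⟩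
    refine ⟨L'.trans L, l.comp L'.toAffineMap + l', fun x => ?_⟩
    rw [h', h]
    simp [add_assoc]

end Bent

section Plane

/-- Subsets of two projective spaces over `F` are projectively equivalent if a collineation induced
by a semilinear bijection maps one onto the other. For `V = W = F ^ 3` this is equivalence
under `PΓL(3, q)`. -/
def ProjEquiv {F V W : Type*} [Field F] [AddCommGroup V] [Module F V] [AddCommGroup W] [Module F W]
    (A : Set (ℙ F V)) (B : Set (ℙ F W)) : Prop :=
  ∃ (σ : F ≃+* F) (φ : V →ₛₗ[(σ : F →+* F)] W) (hφ : Function.Bijective φ),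
    Projectivization.map φ hφ.injective '' A = B

/-- The set `{(u : g(u)) : u ∈ S}` in the model of `PG(2, q)` whose points are the classes `(x : z)`
of the nonzero pairs in `K × F`. Affinely it is `{u / g(u) : u ∈ S}`, where `u / g(u)` is the
point at infinity in the direction `u` if `g(u) = 0`. -/
def oval {F K : Type*} [Field F] [Fintype F] [Field K] [Algebra F K]
    (g : unitCircle F K → F) : Set (ℙ F (K × F)) :=
  Set.range fun u : unitCircle F K =>
    Projectivization.mk F ((u : K), g u) fun h => unitCircle_ne_zero u (Prod.ext_iff.1 h).1

/-- The origin `(0 : 1)` of the affine plane `K`. -/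
def origin (F K : Type*) [Field F] [Field K] [Algebra F K] : ℙ F (K × F) :=
  Projectivization.mk F ((0 : K), (1 : F)) fun h => one_ne_zero (Prod.ext_iff.1 h).2

/-- The hyperoval of a Niho bent function given by `g`: the oval of `g` together with its nucleus,
the origin. -/
def hyperoval {F K : Type*} [Field F] [Fintype F] [Field K] [Algebra F K]
    (g : unitCircle F K → F) : Set (ℙ F (K × F)) :=
  oval g ∪ {origin F K}

/-- The hyperconic `{(t : t² : 1) : t ∈ F} ∪ {(0 : 1 : 0), (1 : 0 : 0)}` in `PG(2, q)`: the conic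
`x² = y z` together with its nucleus `(1 : 0 : 0)`. -/
def hyperconic (F : Type*) [Field F] : Set (ℙ F (Fin 3 → F)) :=
  (Set.range fun t : F => Projectivization.mk F ![t, t ^ 2, 1] (by simp)) ∪
    {Projectivization.mk F ![0, 1, 0] (by simp), Projectivization.mk F ![1, 0, 0] (by simp)}

/-- `f` is a Niho bent function associated with the hyperoval `H`: the oval of `f`, completed by its
nucleus, is projectively equivalent to `H`. -/
def IsAssociatedNihoBent {F K : Type*} [Field F] [Fintype F] [Field K] [Fintype K] [Algebra F K]
    [Algebra (ZMod 2) F] (H : Set (ℙ F (Fin 3 → F))) (f : K → ZMod 2) : Prop :=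
  IsNihoBent F f ∧ ∃ g : unitCircle F K → F, IsGivenBy f g ∧ ProjEquiv (hyperoval g) H

/-- Extended-affine equivalence on the Niho bent functions `K → 𝔽₂` associated with `H`. -/
def nihoSetoid {F : Type*} (K : Type*) [Field F] [Fintype F] [Field K] [Fintype K] [Algebra F K]
    [Algebra (ZMod 2) F] [Algebra (ZMod 2) K] (H : Set (ℙ F (Fin 3 → F))) :
    Setoid {f : K → ZMod 2 // IsAssociatedNihoBent H f} where
  r f f' := EAEquiv (f : K → ZMod 2) (f' : K → ZMod 2)
  iseqv :=
    ⟨fun f => EAEquiv.equivalence.refl f.1, fun h => EAEquiv.equivalence.symm h,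
      fun h h' => EAEquiv.equivalence.trans h h'⟩

end Plane

section Representatives

/-- An exponent `d_i` with `2 ^ r * d_i ≡ (2 ^ m - 1) * i + 2 ^ r` modulo `2 ^ (2 * m) - 1`;
only its residue matters. -/
def nihoExponent (m r i : ℕ) : ℕ :=
  ((2 ^ m - 1) * i + 2 ^ r) * 2 ^ (2 * m - r)

theorem nihoExponent_spec {m r : ℕ} (i : ℕ) (h : r ≤ 2 * m) :
    2 ^ r * nihoExponent m r i ≡ (2 ^ m - 1) * i + 2 ^ r [MOD 2 ^ (2 * m) - 1] := by
  have h1 : 2 ^ r * nihoExponent m r i = ((2 ^ m - 1) * i + 2 ^ r) * 2 ^ (2 * m) := by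
    have h0 : 2 ^ (2 * m) = 2 ^ r * 2 ^ (2 * m - r) := by
      rw [← pow_add, Nat.add_sub_of_le h]
    rw [h0, nihoExponent]
    ring
  have h2 : 2 ^ (2 * m) ≡ 1 [MOD 2 ^ (2 * m) - 1] := by
    have h3 : 2 ^ (2 * m) = 1 + (2 ^ (2 * m) - 1) := (Nat.add_sub_of_le Nat.one_le_two_pow).symm
    conv_lhs => rw [h3]
    simp [Nat.ModEq]
  rw [h1]
  simpa using h2.mul_left ((2 ^ m - 1) * i + 2 ^ r)

/-- `f_r(x) = Tr (a x ^ (2 ^ m + 1) + ∑ x ^ d_i)`, the sum over `1 ≤ i ≤ 2 ^ (r - 1) - 1`; here `Tr` is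
the absolute trace of `K`. For `r = 1` the sum is empty. -/
def nihoF {K : Type*} [Field K] [Algebra (ZMod 2) K] (m : ℕ) (a : K) (r : ℕ) : K → ZMod 2 :=
  fun x => Algebra.trace (ZMod 2) K
    (a * x ^ (2 ^ m + 1) + ∑ i ∈ Finset.Icc 1 (2 ^ (r - 1) - 1), x ^ nihoExponent m r i)

/-- `g_1(u) = 1`. -/
def gFirst (F K : Type*) [Field F] [Fintype F] [Field K] : unitCircle F K → F :=
  fun _ => 1

open Classical in
/-- `g_{m-1}(u) = 1 / (u + ū) + u + ū` for `u ≠ 1`, and `g_{m-1}(1) = 1`; the element `u + ū` of `F` is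
the trace of `u` over `F`. -/
def gLast (F K : Type*) [Field F] [Fintype F] [Field K] [Algebra F K] : unitCircle F K → F :=
  fun u => if (u : K) = 1 then 1 else
    1 / Algebra.trace F K (u : K) + Algebra.trace F K (u : K)

end Representatives

end Niho

end

/-! Write `x = s + t a` with `s, t ∈ F`. Up to an additive function, `f_1` becomes `tr(s² t²)` and
`f_{m-1}` becomes `tr(s² t⁻¹)`, where `0⁻¹ = 0`. Both have the form `maiorana ρ` with `ρ` a
bijection, hence are bent (`sum_sgn_maiorana`). Conversely, let a semilinear `φ` carry the hyperoval
of `f` to the hyperconic. The image of the origin is the nucleus or a point of the conic, and an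
elation moves any point of the conic with nonzero last coordinate to `(0 : 1 : 0)`. So only one
coordinate of `φ(x, w)` depends on `w`, and the equation of the hyperconic expresses it, or its
square, through the other two, which are additive coordinates of `x`. Its trace is `f` of a multiple
of `x` plus an additive function (`addLinked_of_semilinear`). The nucleus yields `tr(s² t²)` and a
conic point `tr(s² t⁻¹)`, so there are at most two classes. The classes differ because degree at
most two is invariant under equivalence: `tr(s² t²)` has it, `tr(s² t⁻¹)` does not for `q > 4`. -/

namespace Niho

/-! ### Boolean functions: quadraticity and additive equivalence. -/

section Functions

/-- All third derivatives of `f` vanish: `f` has algebraic degree at most two. -/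
def IsQuadratic {V : Type*} [AddCommGroup V] (f : V → ZMod 2) : Prop :=
  ∀ x a b c, f x + f (x + a) + f (x + b) + f (x + c) + f (x + a + b) + f (x + a + c)
    + f (x + b + c) + f (x + a + b + c) = 0

/-- `f` agrees with `h` up to an additive bijection and an additive function. -/
def AddLinked {V W : Type*} [AddCommGroup V] [AddCommGroup W] (f : V → ZMod 2)
    (h : W → ZMod 2) : Prop :=
  ∃ (e : V ≃+ W) (l : V →+ ZMod 2), ∀ x, f x = h (e x) + l x

variable {V W : Type*} [AddCommGroup V] [AddCommGroup W]

/-- Third derivatives of the affine term `l` vanish, and those of `h ∘ A` are third derivatives of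
`h` in the directions `D a`. -/
theorem IsQuadratic.comp {h : W → ZMod 2} (hh : IsQuadratic h) {f : V → ZMod 2}
    (A : V → W) (D : V →+ W) (hA : ∀ x a, A (x + a) = A x + D a)
    (l : V → ZMod 2) (n : V →+ ZMod 2) (hl : ∀ x a, l (x + a) = l x + n a)
    (hf : ∀ x, f x = h (A x) + l x) : IsQuadratic f := by
  intro x a b c
  have h0 := hh (A x) (D a) (D b) (D c)
  simp only [hf, hA, hl]
  have h2 : (2 : ZMod 2) = 0 := rfl
  linear_combination h0 + (4 * l x + 2 * n a + 2 * n b + 2 * n c) * h2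

theorem EAEquiv.isQuadratic [Module (ZMod 2) V] {f f' : V → ZMod 2} (h : EAEquiv f f')
    (hf : IsQuadratic f) : IsQuadratic f' := by
  obtain ⟨L, l, h⟩ := h
  refine hf.comp L L.linear.toLinearMap.toAddMonoidHom (fun x a => ?_) l l.linear.toAddMonoidHom
    (fun x a => ?_) h
  · rw [add_comm x a]
    simpa [add_comm] using L.map_vadd x a
  · rw [add_comm x a]
    simpa [add_comm] using l.map_vadd x a

theorem AddLinked.isQuadratic {f : V → ZMod 2} {h : W → ZMod 2} (H : AddLinked f h)
    (hh : IsQuadratic h) : IsQuadratic f := by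
  obtain ⟨e, l, H⟩ := H
  exact hh.comp e e.toAddMonoidHom (fun x a => map_add e x a) l l (fun x a => map_add l x a) H

theorem AddLinked.symm {f : V → ZMod 2} {h : W → ZMod 2} (H : AddLinked f h) :
    AddLinked h f := by
  obtain ⟨e, l, H⟩ := H
  refine ⟨e.symm, l.comp e.symm.toAddMonoidHom, fun x => ?_⟩
  simp [H, add_assoc, CharTwo.add_self_eq_zero]

theorem AddLinked.trans {U : Type*} [AddCommGroup U] {f : V → ZMod 2} {h : W → ZMod 2}
    {k : U → ZMod 2} (H : AddLinked f h) (H' : AddLinked h k) : AddLinked f k := by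
  obtain ⟨e, l, H⟩ := H
  obtain ⟨e', l', H'⟩ := H'
  refine ⟨e.trans e', l + l'.comp e.toAddMonoidHom, fun x => ?_⟩
  simp [H, H']
  ring

/-- Additive maps between `𝔽₂`-spaces are automatically linear. -/
theorem AddLinked.eaEquiv [Module (ZMod 2) V] {f f' : V → ZMod 2} (H : AddLinked f f') :
    EAEquiv f f' := by
  obtain ⟨e, l, H⟩ := H.symm
  let e' : V ≃ₗ[ZMod 2] V :=
    LinearEquiv.ofBijective (e.toAddMonoidHom.toZModLinearMap 2) e.bijective
  exact ⟨e'.toAffineEquiv, (l.toZModLinearMap 2).toAffineMap, H⟩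

end Functions

/-! ### The absolute trace and the two model functions. -/

section Trace

variable {F : Type*} [Field F] [Fintype F] [Algebra (ZMod 2) F]

theorem charTwo (R : Type*) [Ring R] [Nontrivial R] [Algebra (ZMod 2) R] : CharP R 2 :=
  charP_of_injective_algebraMap (algebraMap (ZMod 2) R).injective 2

theorem trace_ringEquiv (σ : F ≃+* F) (x : F) :
    Algebra.trace (ZMod 2) F (σ x) = Algebra.trace (ZMod 2) F x :=
  Algebra.trace_eq_of_algEquiv (AlgEquiv.ofRingEquiv (R := ZMod 2) (f := σ) fun r =>
    congrArg (fun g : ZMod 2 →+* F => g r)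
      (Subsingleton.elim ((σ : F →+* F).comp (algebraMap _ _)) (algebraMap _ _))) x

theorem trace_sq (x : F) :
    Algebra.trace (ZMod 2) F (x ^ 2) = Algebra.trace (ZMod 2) F x := by
  have := charTwo F
  exact trace_ringEquiv (frobeniusEquiv F 2) x

theorem exists_sq_eq (x : F) : ∃ y : F, y ^ 2 = x := by
  have := charTwo F
  exact (frobeniusEquiv F 2).surjective x

theorem sq_injective {R : Type*} [Field R] [Algebra (ZMod 2) R] :
    Function.Injective fun x : R => x ^ 2 := by
  have := charTwo R
  exact frobenius_inj R 2

theorem exists_trace_mul_ne_zero {x : F} (hx : x ≠ 0) :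
    ∃ y, Algebra.trace (ZMod 2) F (x * y) ≠ 0 := by
  by_contra! h
  exact hx ((traceForm_nondegenerate (ZMod 2) F).1 x h)

/-- The Boolean function `(s, t) ↦ tr (s² ρ(t))` of Maiorana–McFarland type. -/
noncomputable def maiorana (ρ : F → F) (p : F × F) : ZMod 2 :=
  Algebra.trace (ZMod 2) F (p.1 ^ 2 * ρ p.2)

theorem isQuadratic_maiorana_sq : IsQuadratic (maiorana fun t : F => t ^ 2) := by
  have := charTwo F
  intro x a b c
  simp only [maiorana, ← map_add]
  convert map_zero (Algebra.trace (ZMod 2) F)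
  simp only [Prod.fst_add, Prod.snd_add, CharTwo.add_sq]
  ring_nf
  simp [CharTwo.ofNat_eq_mod]

/-- A vanishing third derivative would make every `k` other than `0, 1` a root of `X² + X + 1`,
leaving at most four elements in `F`. -/
theorem not_isQuadratic_maiorana_inv (h4 : 4 < Fintype.card F) :
    ¬ IsQuadratic (maiorana fun t : F => t⁻¹) := by
  classical
  have := charTwo F
  intro H
  have key : ∀ k : F, k⁻¹ + 1 + (k + 1)⁻¹ = 0 := by
    intro k
    by_contra hk
    obtain ⟨y, hy⟩ := exists_trace_mul_ne_zero hk
    obtain ⟨s, rfl⟩ := exists_sq_eq y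
    apply hy
    -- Only the three summands with first entry `s` and second entry `k`, `1`, `k + 1` can be
    -- nonzero; the one at `(s, 0)` vanishes since `0⁻¹ = 0`.
    have := H (0, 0) (s, 0) (0, k) (0, 1)
    simpa [maiorana, ← map_add, add_mul, mul_comm] using this
  have root : ∀ k : F, k ≠ 0 → k ≠ 1 → k ^ 2 + k + 1 = 0 := by
    intro k h0 h1
    have h1' : k + 1 ≠ 0 := fun h => h1 (CharTwo.add_eq_zero.1 h)
    have h := key k
    field_simp at h
    linear_combination h - k * CharTwo.two_eq_zero (R := F)
  obtain ⟨k, -, hk⟩ := Finset.exists_mem_notMem_of_card_lt_card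
    (s := ({0, 1} : Finset F)) (t := Finset.univ)
    (lt_of_le_of_lt Finset.card_le_two (by rw [Finset.card_univ]; omega))
  obtain ⟨l, -, hl⟩ := Finset.exists_mem_notMem_of_card_lt_card
    (s := ({0, 1, k, k + 1} : Finset F)) (t := Finset.univ)
    (lt_of_le_of_lt Finset.card_le_four (by rw [Finset.card_univ]; omega))
  simp only [Finset.mem_insert, Finset.mem_singleton, not_or] at hk hl
  have e1 := root k hk.1 hk.2
  have e2 := root l hl.1 hl.2.1
  -- If `k` is one root of `X² + X + 1`, the other is `k + 1`.
  have : (l + k) * (l + (k + 1)) = 0 := by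
    linear_combination e1 + e2 + (l * k - 1) * CharTwo.two_eq_zero (R := F)
  rcases mul_eq_zero.1 this with h | h
  · exact hl.2.2.1 (CharTwo.add_eq_zero.1 h)
  · exact hl.2.2.2 (CharTwo.add_eq_zero.1 h)

end Trace

/-! ### Character sums. -/

section Sums

/-- The sign `(-1) ^ a` of `a : 𝔽₂`. -/
def sgn (a : ZMod 2) : ℤ := (-1) ^ a.val

theorem sgn_add (a b : ZMod 2) : sgn (a + b) = sgn a * sgn b := by
  revert a b
  decide

theorem sgn_eq_or (a : ZMod 2) : sgn a = 1 ∨ sgn a = -1 := by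
  revert a
  decide

variable {F : Type*} [Field F] [Fintype F] [Algebra (ZMod 2) F]

/-- Translation by an element `y` with `tr(c y) = 1` changes the sign of the sum. -/
theorem sum_sgn_trace {c : F} (hc : c ≠ 0) :
    ∑ x : F, sgn (Algebra.trace (ZMod 2) F (c * x)) = 0 := by
  obtain ⟨y, hy⟩ := exists_trace_mul_ne_zero hc
  have h1 : sgn (Algebra.trace (ZMod 2) F (c * y)) = -1 := by
    revert hy
    generalize Algebra.trace (ZMod 2) F (c * y) = z
    revert z
    decide
  have h := Equiv.sum_comp (Equiv.addRight y)
    fun x : F => sgn (Algebra.trace (ZMod 2) F (c * x))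
  simp only [Equiv.coe_addRight, mul_add, map_add, sgn_add, h1, ← Finset.sum_mul] at h
  linarith

/-- For fixed `t`, `tr(α s) = tr(α² s²)` makes the exponent additive in `s²` with coefficient `ρ(t)
+ α²`. So only the unique `t₀` with `ρ(t₀) = α²` contributes. -/
theorem sum_sgn_maiorana {ρ : F → F} (hρ : Function.Bijective ρ) (α β : F) :
    ∃ z : ZMod 2, ∑ p : F × F, sgn (maiorana ρ p
      + Algebra.trace (ZMod 2) F (α * p.1 + β * p.2)) = sgn z * Fintype.card F := by
  classical
  have := charTwo F
  obtain ⟨t₀, ht₀⟩ := hρ.2 (α ^ 2)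
  refine ⟨Algebra.trace (ZMod 2) F (β * t₀), ?_⟩
  have inner : ∀ t : F, ∑ s : F, sgn (maiorana ρ (s, t)
      + Algebra.trace (ZMod 2) F (α * s + β * t)) =
      if t = t₀ then sgn (Algebra.trace (ZMod 2) F (β * t₀)) * Fintype.card F else 0 := by
    intro t
    have h1 : ∀ s : F, sgn (maiorana ρ (s, t) + Algebra.trace (ZMod 2) F (α * s + β * t)) =
        sgn (Algebra.trace (ZMod 2) F (β * t)) *
          sgn (Algebra.trace (ZMod 2) F ((ρ t + α ^ 2) * frobeniusEquiv F 2 s)) := by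
      intro s
      rw [← sgn_add, maiorana, map_add, ← trace_sq (α * s)]
      simp only [← map_add, frobeniusEquiv_def]
      congr 2
      ring
    simp only [h1, ← Finset.mul_sum]
    have h2 := (frobeniusEquiv F 2).toEquiv.sum_comp
      fun s : F => sgn (Algebra.trace (ZMod 2) F ((ρ t + α ^ 2) * s))
    simp only [RingEquiv.toEquiv_eq_coe, RingEquiv.coe_toEquiv] at h2
    rw [h2]
    split_ifs with h
    · subst h
      simp [ht₀, CharTwo.add_self_eq_zero, sgn]
    · rw [sum_sgn_trace, mul_zero]
      intro h0
      exact h (hρ.1 (ht₀.symm ▸ CharTwo.add_eq_zero.1 h0))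
  rw [Fintype.sum_prod_type_right]
  simp only [inner]
  simp

end Sums
-- Conjugation, polar form and the coordinates `x = s + t a`.
section Coordinates

variable {F K : Type*} [Field F] [Fintype F] [Field K] [Fintype K] [Algebra F K]

theorem algebraMap_trace_eq (hK : Fintype.card K = Fintype.card F ^ 2) (x : K) :
    algebraMap F K (Algebra.trace F K x) = x + conj F x := by
  have h : Module.finrank F K = 2 := by
    have h1 := Module.card_eq_pow_finrank (K := F) (V := K)
    exact (Nat.pow_right_injective Fintype.one_lt_card (hK.symm.trans h1)).symm
  rw [FiniteField.algebraMap_trace_eq_sum_pow, h]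
  simp [Finset.sum_range_succ, conj, Nat.card_eq_fintype_card]

theorem conj_mul (x y : K) : conj F (x * y) = conj F x * conj F y := mul_pow _ _ _

theorem conj_algebraMap (c : F) : conj F (algebraMap F K c) = algebraMap F K c := by
  rw [conj, ← map_pow, FiniteField.pow_card]

theorem conj_conj (hK : Fintype.card K = Fintype.card F ^ 2) (x : K) :
    conj F (conj F x) = x := by
  rw [conj, conj, ← pow_mul, ← sq, ← hK, FiniteField.pow_card]

theorem conj_add [Algebra (ZMod 2) K] (hK : Fintype.card K = Fintype.card F ^ 2) (x y : K) :
    conj F (x + y) = conj F x + conj F y := by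
  have h := fun z => algebraMap_trace_eq (F := F) hK z
  have := h (x + y)
  rw [map_add, map_add, h, h] at this
  linear_combination -this

/-- Since `a` has trace `1`, `y ↦ T(a y)` descends conjugation-invariant elements of `K` to `F`. -/
theorem algebraMap_trace_mul_of_conj_eq (hK : Fintype.card K = Fintype.card F ^ 2) {a : K}
    (ha : a + conj F a = 1) {y : K} (hy : conj F y = y) :
    algebraMap F K (Algebra.trace F K (a * y)) = y := by
  rw [algebraMap_trace_eq hK, conj_mul, hy, ← add_mul, ha, one_mul]

theorem exists_algebraMap_eq_mul_conj (hK : Fintype.card K = Fintype.card F ^ 2) {a : K}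
    (ha : a + conj F a = 1) (x : K) : ∃ n : F, algebraMap F K n = x * conj F x :=
  ⟨_, algebraMap_trace_mul_of_conj_eq hK ha (by rw [conj_mul, conj_conj hK, mul_comm])⟩

theorem trace_eq_one_of_add_conj (hK : Fintype.card K = Fintype.card F ^ 2) {a : K}
    (ha : a + conj F a = 1) : Algebra.trace F K a = 1 := by
  apply (algebraMap F K).injective
  rw [algebraMap_trace_eq hK, ha, map_one]

theorem trace_algebraMap_eq_zero [Algebra (ZMod 2) K]
    (hK : Fintype.card K = Fintype.card F ^ 2) (c : F) :
    Algebra.trace F K (algebraMap F K c) = 0 := by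
  have := charTwo K
  apply (algebraMap F K).injective
  rw [algebraMap_trace_eq hK, conj_algebraMap, CharTwo.add_self_eq_zero, map_zero]

theorem trace_algebraMap_mul (c : F) (x : K) :
    Algebra.trace F K (algebraMap F K c * x) = c * Algebra.trace F K x := by
  rw [← Algebra.smul_def, map_smul, smul_eq_mul]

/-- The radius `c` is the square root of the norm of `x`, which exists in characteristic two. -/
theorem exists_polar [Algebra (ZMod 2) F] (hK : Fintype.card K = Fintype.card F ^ 2) {a : K}
    (ha : a + conj F a = 1) (x : K) :
    ∃ (c : F) (u : unitCircle F K), x = algebraMap F K c * u := by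
  obtain ⟨n, hn⟩ := exists_algebraMap_eq_mul_conj hK ha x
  obtain ⟨c, rfl⟩ := exists_sq_eq n
  by_cases hx : x = 0
  · refine ⟨0, ⟨1, by simp [unitCircle, conj]⟩, by simp [hx]⟩
  have hxc : conj F x ≠ 0 := pow_ne_zero _ hx
  have hc : algebraMap F K c ≠ 0 := by
    intro h
    rw [map_pow, h] at hn
    exact mul_ne_zero hx hxc (by rw [← hn]; simp)
  refine ⟨c, ⟨(algebraMap F K c)⁻¹ * x, ?_⟩, by field_simp⟩
  rw [map_pow] at hn
  rw [unitCircle, Set.mem_ofPred_eq, ← map_inv₀, conj_mul, conj_algebraMap, map_inv₀]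
  field_simp
  exact hn.symm

/-- Independence of `1` and `a` follows from `T(F) = 0` and `T(a) = 1`. -/
theorem exists_coordinates [Algebra (ZMod 2) K] (hK : Fintype.card K = Fintype.card F ^ 2)
    {a : K} (ha : a + conj F a = 1) :
    ∃ E : (F × F) ≃ₗ[F] K, ∀ p, E p = algebraMap F K p.1 + algebraMap F K p.2 * a := by
  let e : (F × F) →ₗ[F] K :=
    (LinearMap.toSpanSingleton F K 1).coprod (LinearMap.toSpanSingleton F K a)
  have he : ∀ p, e p = algebraMap F K p.1 + algebraMap F K p.2 * a := by
    intro p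
    simp [e, Algebra.smul_def]
  have hinj : Function.Injective e := by
    rw [injective_iff_map_eq_zero]
    rintro ⟨s, t⟩ h
    rw [he] at h
    have ht : t = 0 := by
      have := congrArg (Algebra.trace F K) h
      rwa [map_add, trace_algebraMap_eq_zero hK, trace_algebraMap_mul,
        trace_eq_one_of_add_conj hK ha, map_zero, zero_add, mul_one] at this
    subst ht
    simpa using h
  refine ⟨LinearEquiv.ofBijective e ((Fintype.bijective_iff_injective_and_card e).2
    ⟨hinj, by rw [hK, Fintype.card_prod, sq]⟩), he⟩

theorem trace_coordinates [Algebra (ZMod 2) K] (hK : Fintype.card K = Fintype.card F ^ 2)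
    {a : K} (ha : a + conj F a = 1) (s t : F) :
    Algebra.trace F K (algebraMap F K s + algebraMap F K t * a) = t := by
  rw [map_add, trace_algebraMap_eq_zero hK, trace_algebraMap_mul,
    trace_eq_one_of_add_conj hK ha, zero_add, mul_one]

theorem norm_coordinates [Algebra (ZMod 2) K] (hK : Fintype.card K = Fintype.card F ^ 2)
    {a : K} (ha : a + conj F a = 1) {δ : F} (hδ : algebraMap F K δ = a * conj F a) (s t : F) :
    (algebraMap F K s + algebraMap F K t * a) * conj F (algebraMap F K s + algebraMap F K t * a)
      = algebraMap F K (s ^ 2 + s * t + δ * t ^ 2) := by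
  rw [conj_add hK, conj_mul, conj_algebraMap, conj_algebraMap]
  simp only [map_add, map_mul, map_pow]
  linear_combination algebraMap F K s * algebraMap F K t * ha - algebraMap F K t ^ 2 * hδ

/-- In coordinates `⟨b, x⟩` is a linear form in `(s, t)`, so each Walsh coefficient is a sum from
`sum_sgn_maiorana`. -/
theorem isBent_of_maiorana [Algebra (ZMod 2) F] {E : (F × F) ≃ₗ[F] K} {f : K → ZMod 2}
    {ρ : F → F} (hρ : Function.Bijective ρ) (α β : F)
    (hf : ∀ p, f (E p) = maiorana ρ p + Algebra.trace (ZMod 2) F (α * p.1 + β * p.2))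
    (hadd : ∀ x y : K, conj F (x + y) = conj F x + conj F y) :
    IsBent F f := by
  intro b
  have hform : ∀ p : F × F, form F b (E p) =
      form F b (E (1, 0)) * p.1 + form F b (E (0, 1)) * p.2 := by
    intro p
    have hp : E p = algebraMap F K p.1 * E (1, 0) + algebraMap F K p.2 * E (0, 1) := by
      rw [← Algebra.smul_def, ← Algebra.smul_def, ← map_smul, ← map_smul, ← map_add]
      simp
    rw [hp, form, hadd, conj_mul, conj_mul, conj_algebraMap, conj_algebraMap, mul_add,
      mul_left_comm, mul_left_comm b, map_add, trace_algebraMap_mul, trace_algebraMap_mul,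
      form, form, mul_comm p.1, mul_comm p.2]
  obtain ⟨z, hz⟩ := sum_sgn_maiorana hρ (α + form F b (E (1, 0))) (β + form F b (E (0, 1)))
  have hw : walsh F f b = sgn z * Fintype.card F := by
    rw [← hz, walsh, ← Equiv.sum_comp E.toEquiv]
    refine Finset.sum_congr rfl fun p _ => ?_
    change sgn (f (E p) + Algebra.trace (ZMod 2) F (form F b (E p))) = _
    rw [hf, hform, add_assoc, ← map_add]
    congr 3
    ring
  rcases sgn_eq_or z with h | h <;> rw [hw, h] <;> simp

theorem isNihoBent_of_isGivenBy [Algebra (ZMod 2) F] {f : K → ZMod 2} (hf : IsBent F f)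
    {g : unitCircle F K → F} (hg : IsGivenBy f g) : IsNihoBent F f := by
  refine ⟨hf, fun u hu => ⟨(Algebra.trace (ZMod 2) F).comp
    (LinearMap.mulRight (ZMod 2) (g ⟨u, hu⟩)), fun c => ?_⟩⟩
  simpa using hg c ⟨u, hu⟩

end Coordinates

/-! ### Homogeneous descriptions of the hyperconic and of the hyperoval of `g`. -/

section Hyperovals

/-- `v` lies on the cone over the hyperconic. -/
def OnHyperconic {F : Type*} [Field F] (v : Fin 3 → F) : Prop :=
  v 0 ^ 2 = v 1 * v 2 ∨ (v 1 = 0 ∧ v 2 = 0)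

theorem OnHyperconic.smul {F : Type*} [Field F] {v : Fin 3 → F} (h : OnHyperconic v) (c : F) :
    OnHyperconic (c • v) := by
  rcases h with h | ⟨h1, h2⟩
  · left
    simp only [Pi.smul_apply, smul_eq_mul]
    linear_combination c ^ 2 * h
  · right
    simp [h1, h2]

theorem mk_mem_hyperconic {F : Type*} [Field F] (v : Fin 3 → F) (hv : v ≠ 0) :
    Projectivization.mk F v hv ∈ hyperconic F ↔ OnHyperconic v := by
  constructor
  · rintro (⟨t, ht⟩ | h | h)
    · obtain ⟨c, rfl⟩ := (Projectivization.mk_eq_mk_iff' F _ _ _ _).1 ht.symm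
      apply OnHyperconic.smul
      left
      simp
    · obtain ⟨c, rfl⟩ := (Projectivization.mk_eq_mk_iff' F _ _ _ _).1 h
      apply OnHyperconic.smul
      left
      simp
    · obtain ⟨c, rfl⟩ := (Projectivization.mk_eq_mk_iff' F _ _ _ _).1 h
      apply OnHyperconic.smul
      right
      simp
  · intro h
    by_cases h2 : v 2 = 0
    · right
      by_cases h1 : v 1 = 0
      · right
        refine (Projectivization.mk_eq_mk_iff' F _ _ _ _).2 ⟨v 0, ?_⟩
        ext i
        fin_cases i <;> simp [h1, h2]
      · left
        have h0 : v 0 = 0 := by simpa [OnHyperconic, h1, h2] using h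
        refine (Projectivization.mk_eq_mk_iff' F _ _ _ _).2 ⟨v 1, ?_⟩
        ext i
        fin_cases i <;> simp [h0, h2]
    · left
      have h0 : v 0 ^ 2 = v 1 * v 2 := by simpa [OnHyperconic, h2] using h
      refine ⟨v 0 / v 2, (Projectivization.mk_eq_mk_iff' F _ _ _ _).2 ⟨(v 2)⁻¹, ?_⟩⟩
      ext i
      fin_cases i
      · simp [div_eq_inv_mul]
      · simp only [Fin.mk_one, Pi.smul_apply, smul_eq_mul, Matrix.cons_val_one,
          Matrix.cons_val_zero, div_pow, h0]
        field_simp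
      · simp [h2]

variable {F K : Type*} [Field F] [Fintype F] [Field K] [Algebra F K]

theorem mk_mem_hyperoval (g : unitCircle F K → F) (x : K) (z : F) (h : (x, z) ≠ 0) :
    Projectivization.mk F (x, z) h ∈ hyperoval g ↔
      x = 0 ∨ ∃ (c : F) (u : unitCircle F K), x = algebraMap F K c * u ∧ z = c * g u := by
  constructor
  · rintro (⟨u, hu⟩ | h0)
    · obtain ⟨c, hc⟩ := (Projectivization.mk_eq_mk_iff' F _ _ _ _).1 hu.symm
      right
      refine ⟨c, u, ?_, ?_⟩
      · simpa [Algebra.smul_def] using (congrArg Prod.fst hc).symm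
      · simpa using (congrArg Prod.snd hc).symm
    · obtain ⟨c, hc⟩ := (Projectivization.mk_eq_mk_iff' F _ _ _ _).1 h0
      left
      simpa using (congrArg Prod.fst hc).symm
  · rintro (rfl | ⟨c, u, rfl, rfl⟩)
    · right
      exact (Projectivization.mk_eq_mk_iff' F _ _ _ _).2 ⟨z, by simp⟩
    · left
      exact ⟨u, ((Projectivization.mk_eq_mk_iff' F _ _ _ _).2
        ⟨c, by simp [Algebra.smul_def]⟩).symm⟩

/-- The homogeneous extension `c u ↦ c g(u)` is `h` in coordinates; the cone over the hyperoval is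
its graph together with the line through the origin, so a linear `Ψ` taking this set to the
hyperconic cone suffices. -/
theorem projEquiv_hyperoval_hyperconic {g : unitCircle F K → F} (E : (F × F) ≃ₗ[F] K)
    (hpol : ∀ x : K, ∃ (c : F) (u : unitCircle F K), x = algebraMap F K c * u)
    {h : F × F → F} (hg : ∀ c u p, E p = algebraMap F K c * (u : unitCircle F K) → c * g u = h p)
    (Ψ : ((F × F) × F) ≃ₗ[F] (Fin 3 → F))
    (hΨ : ∀ p z, OnHyperconic (Ψ (p, z)) ↔ p = 0 ∨ z = h p) :
    ProjEquiv (hyperoval g) (hyperconic F) := by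
  let Φ : (K × F) ≃ₗ[F] (Fin 3 → F) := (E.symm.prodCongr (LinearEquiv.refl F F)).trans Ψ
  have hmem : ∀ (y : K × F) (hy : y ≠ 0),
      Projectivization.mk F y hy ∈ hyperoval g ↔ OnHyperconic (Φ y) := by
    rintro ⟨x, z⟩ hy
    obtain ⟨p, rfl⟩ := E.surjective x
    have hΦ : Φ (E p, z) = Ψ (p, z) := by simp [Φ]
    rw [mk_mem_hyperoval, hΦ, hΨ, map_eq_zero_iff E E.injective]
    refine or_congr_right ⟨?_, fun hz => ?_⟩
    · rintro ⟨c, u, hx, rfl⟩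
      exact hg c u p hx
    · obtain ⟨c, u, hx⟩ := hpol (E p)
      exact ⟨c, u, hx, by rw [hg c u p hx, hz]⟩
  refine ⟨RingEquiv.refl F,
    { toFun := Φ, map_add' := map_add Φ, map_smul' := map_smul Φ }, Φ.bijective, ?_⟩
  ext P
  constructor
  · rintro ⟨Q, hQ, rfl⟩
    induction Q using Projectivization.ind with
    | h y hy =>
      rw [Projectivization.map_mk, mk_mem_hyperconic]
      exact (hmem y hy).1 hQ
  · intro hP
    induction P using Projectivization.ind with
    | h v hv =>
      have hy : Φ.symm v ≠ 0 := by simpa using hv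
      refine ⟨Projectivization.mk F (Φ.symm v) hy, (hmem _ hy).2 ?_, ?_⟩
      · rw [LinearEquiv.apply_symm_apply]
        exact (mk_mem_hyperconic v hv).1 hP
      · rw [Projectivization.map_mk]
        exact (Projectivization.mk_eq_mk_iff' F _ _ _ _).2 ⟨1, by
          rw [one_smul]
          exact (Φ.apply_symm_apply v).symm⟩

end Hyperovals
-- Every associated function is linked to one of the two models.
section Classification

variable {F K : Type*} [Field F] [Fintype F] [Field K] [Fintype K] [Algebra F K]
  [Algebra (ZMod 2) F] {σ : F ≃+* F}

/-- For `x = c u` take `w = c g(u)`: both the formula for `f` and the cone condition are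
homogeneous. -/
theorem exists_onHyperconic {f : K → ZMod 2} {g : unitCircle F K → F} (hg : IsGivenBy f g)
    (hpol : ∀ x : K, ∃ (c : F) (u : unitCircle F K), x = algebraMap F K c * u)
    (φ : (K × F) →ₛₗ[(σ : F →+* F)] (Fin 3 → F))
    (hφ : ∀ u : unitCircle F K, OnHyperconic (φ ((u : K), g u))) (x : K) :
    ∃ w : F, (∀ d : F, f (algebraMap F K d * x) = Algebra.trace (ZMod 2) F (d * w)) ∧
      OnHyperconic (φ (x, w)) := by
  obtain ⟨c, u, rfl⟩ := hpol x
  refine ⟨c * g u, fun d => ?_, ?_⟩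
  · rw [← mul_assoc, ← map_mul, hg, mul_assoc]
  · have : (algebraMap F K c * (u : K), c * g u) = c • ((u : K), g u) := by
      simp [Algebra.smul_def]
    rw [this, map_smulₛₗ]
    exact (hφ u).smul _

theorem semilinear_apply (φ : (K × F) →ₛₗ[(σ : F →+* F)] (Fin 3 → F)) (x : K) (w : F)
    (i : Fin 3) : φ (x, w) i = φ (x, 0) i + σ w * φ (0, 1) i := by
  have : (x, w) = (x, 0) + w • ((0 : K), (1 : F)) := by simp
  rw [this, map_add, map_smulₛₗ]
  rfl

/-- If the coordinates `i` and `j` vanish at the origin, they induce an additive bijection. -/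
theorem exists_addEquiv_of_apply_origin (hK : Fintype.card K = Fintype.card F ^ 2)
    (φ : (K × F) →ₛₗ[(σ : F →+* F)] (Fin 3 → F)) (hφ : Function.Injective φ)
    {i j k : Fin 3} (hijk : ∀ l, l = i ∨ l = j ∨ l = k)
    (hi : φ (0, 1) i = 0) (hj : φ (0, 1) j = 0) (d : K) (hd : d ≠ 0) :
    ∃ e : K ≃+ F × F, ∀ x, e x = (φ (d * x, 0) i, φ (d * x, 0) j) := by
  let e : K →+ F × F :=
    { toFun := fun x => (φ (d * x, 0) i, φ (d * x, 0) j)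
      map_zero' := by simp [← Prod.zero_eq_mk]
      map_add' := fun x y => by
        have : (d * (x + y), (0 : F)) = (d * x, 0) + (d * y, 0) := by simp [mul_add]
        rw [this, map_add]
        rfl }
  have hk : φ (0, 1) k ≠ 0 := by
    intro hk
    have h0 : φ (0, 1) = 0 := by
      ext l
      rcases hijk l with rfl | rfl | rfl <;> assumption
    rw [map_eq_zero_iff φ hφ] at h0
    simp at h0
  have hinj : Function.Injective e := by
    rw [injective_iff_map_eq_zero]
    intro x hx
    have h1 : φ (d * x, 0) i = 0 := congrArg Prod.fst hx
    have h2 : φ (d * x, 0) j = 0 := congrArg Prod.snd hx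
    -- The second entry is chosen to cancel coordinate `k`; injectivity of `φ` then forces `d * x =
    -- 0`.
    have h0 : φ (d * x, σ.symm (-(φ (d * x, 0) k) / φ (0, 1) k)) = 0 := by
      ext l
      rw [semilinear_apply]
      rcases hijk l with rfl | rfl | rfl
      · simp [h1, hi]
      · simp [h2, hj]
      · simp [hk]
    rw [map_eq_zero_iff φ hφ] at h0
    have h3 : d * x = 0 := congrArg Prod.fst h0
    exact (mul_eq_zero.1 h3).resolve_left hd
  exact ⟨AddEquiv.ofBijective e ((Fintype.bijective_iff_injective_and_card e).2
    ⟨hinj, by rw [hK, Fintype.card_prod, sq]⟩), fun x => rfl⟩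

/-- Coordinate `k` of `φ(x, w)` is additive in `x` plus `σ(w) φ(0, 1)_k`, and the trace of the
latter is `tr(d w) = f(d x)` for `d = σ⁻¹(φ(0, 1)_k)`. Replacing `x` by `d⁻¹ x` leaves `f(x)`. -/
theorem addLinked_of_semilinear (hK : Fintype.card K = Fintype.card F ^ 2)
    (φ : (K × F) →ₛₗ[(σ : F →+* F)] (Fin 3 → F)) (hφ : Function.Injective φ)
    {f : K → ZMod 2} {i j k : Fin 3} (hijk : ∀ l, l = i ∨ l = j ∨ l = k)
    (hi : φ (0, 1) i = 0) (hj : φ (0, 1) j = 0) {ρ : F → F}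
    (hf : ∀ x, ∃ w : F, (∀ d : F, f (algebraMap F K d * x) =
        Algebra.trace (ZMod 2) F (d * w)) ∧
      Algebra.trace (ZMod 2) F (φ (x, w) k) = maiorana ρ (φ (x, 0) i, φ (x, 0) j)) :
    AddLinked f (maiorana ρ) := by
  have hk : φ (0, 1) k ≠ 0 := by
    intro hk
    have h0 : φ (0, 1) = 0 := by
      ext l
      rcases hijk l with rfl | rfl | rfl <;> assumption
    rw [map_eq_zero_iff φ hφ] at h0
    simp at h0
  set d : F := σ.symm (φ (0, 1) k) with hd
  have hd0 : d ≠ 0 := by simpa [hd] using hk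
  have hdK : (algebraMap F K d)⁻¹ ≠ 0 := by simpa using hd0
  obtain ⟨e, he⟩ := exists_addEquiv_of_apply_origin hK φ hφ hijk hi hj _ hdK
  let l : K →+ ZMod 2 :=
    { toFun := fun x => Algebra.trace (ZMod 2) F (φ ((algebraMap F K d)⁻¹ * x, 0) k)
      map_zero' := by simp [← Prod.zero_eq_mk]
      map_add' := fun x y => by
        have : ((algebraMap F K d)⁻¹ * (x + y), (0 : F)) =
          ((algebraMap F K d)⁻¹ * x, 0) + ((algebraMap F K d)⁻¹ * y, 0) := by simp [mul_add]
        rw [this, map_add, Pi.add_apply, map_add] }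
  refine ⟨e, l, fun x => ?_⟩
  obtain ⟨w, hw, hQ⟩ := hf ((algebraMap F K d)⁻¹ * x)
  have hx := hw d
  rw [mul_inv_cancel_left₀ (by simpa using hd0)] at hx
  rw [he, ← hQ, hx, semilinear_apply, ← trace_ringEquiv σ, map_mul σ, hd, σ.apply_symm_apply,
    mul_comm (φ (0, 1) k)]
  change _ = _ + Algebra.trace (ZMod 2) F (φ ((algebraMap F K d)⁻¹ * x, 0) k)
  rw [map_add, add_right_comm, CharTwo.add_self_eq_zero, zero_add]

/-- If the origin goes to `(0 : 1 : 0)`, solve the conic equation as `v₁ = v₀² v₂⁻¹`. If it goes to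
the nucleus `(1 : 0 : 0)`, use `tr(v₀) = tr(v₀²) = tr(v₁ v₂)`. -/
theorem addLinked_maiorana_of_origin (hK : Fintype.card K = Fintype.card F ^ 2)
    {f : K → ZMod 2} {g : unitCircle F K → F} (hg : IsGivenBy f g)
    (hpol : ∀ x : K, ∃ (c : F) (u : unitCircle F K), x = algebraMap F K c * u)
    (φ : (K × F) →ₛₗ[(σ : F →+* F)] (Fin 3 → F)) (hφ : Function.Injective φ)
    (hu : ∀ u : unitCircle F K, OnHyperconic (φ ((u : K), g u)))
    (h2 : φ (0, 1) 2 = 0) (h01 : φ (0, 1) 0 = 0 ∨ φ (0, 1) 1 = 0) :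
    AddLinked f (maiorana fun t : F => t ^ 2) ∨ AddLinked f (maiorana fun t : F => t⁻¹) := by
  have f0 : ∀ d : F, f (algebraMap F K d * 0) = Algebra.trace (ZMod 2) F (d * 0) := by
    intro d
    obtain ⟨c, u, -⟩ := hpol 0
    simpa using hg 0 u
  have hinj : ∀ (x : K) {i j k : Fin 3}, (∀ l, l = i ∨ l = j ∨ l = k) →
      φ (0, 1) i = 0 → φ (0, 1) j = 0 → φ (x, 0) i = 0 → φ (x, 0) j = 0 → x = 0 := by
    intro x i j k hijk hi hj hxi hxj
    obtain ⟨e, he⟩ := exists_addEquiv_of_apply_origin hK φ hφ hijk hi hj 1 one_ne_zero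
    apply e.injective
    rw [map_zero, he, one_mul, hxi, hxj, Prod.zero_eq_mk]
  rcases h01 with h0 | h1
  · right
    have hijk : ∀ l : Fin 3, l = 0 ∨ l = 2 ∨ l = 1 := by decide
    refine addLinked_of_semilinear hK φ hφ hijk h0 h2 fun x => ?_
    obtain ⟨w, hw, hQ⟩ := exists_onHyperconic hg hpol φ hu x
    by_cases hx : x = 0
    · subst hx
      exact ⟨0, f0, by simp [← Prod.zero_eq_mk, maiorana]⟩
    refine ⟨w, hw, ?_⟩
    have e0 : φ (x, w) 0 = φ (x, 0) 0 := by rw [semilinear_apply, h0, mul_zero, add_zero]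
    have e2 : φ (x, w) 2 = φ (x, 0) 2 := by rw [semilinear_apply, h2, mul_zero, add_zero]
    rw [maiorana]
    congr 1
    -- For `v₂ = 0` and `x ≠ 0` only the nucleus is possible, where `v₁ = 0` agrees with the
    -- convention `0⁻¹ = 0`.
    by_cases hz : φ (x, 0) 2 = 0
    · rcases hQ with hQ | hQ
      · rw [e0, e2, hz, mul_zero] at hQ
        exact absurd (hinj x hijk h0 h2 (pow_eq_zero_iff two_ne_zero |>.1 hQ) hz) hx
      · simp [hz, hQ.1]
    · rcases hQ with hQ | hQ
      · rw [e0, e2] at hQ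
        rw [hQ]
        field_simp
      · exact absurd (e2 ▸ hQ.2) hz
  · left
    have hijk : ∀ l : Fin 3, l = 1 ∨ l = 2 ∨ l = 0 := by decide
    refine addLinked_of_semilinear hK φ hφ hijk h1 h2 fun x => ?_
    obtain ⟨w, hw, hQ⟩ := exists_onHyperconic hg hpol φ hu x
    by_cases hx : x = 0
    · subst hx
      exact ⟨0, f0, by simp [← Prod.zero_eq_mk, maiorana]⟩
    refine ⟨w, hw, ?_⟩
    have e1 : φ (x, w) 1 = φ (x, 0) 1 := by rw [semilinear_apply, h1, mul_zero, add_zero]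
    have e2 : φ (x, w) 2 = φ (x, 0) 2 := by rw [semilinear_apply, h2, mul_zero, add_zero]
    rcases hQ with hQ | hQ
    · rw [maiorana, ← trace_sq, hQ, e1, e2, ← mul_pow, trace_sq]
    · rw [e1, e2] at hQ
      exact absurd (hinj x hijk h1 h2 hQ.1 hQ.2) hx

/-- The elation `(x, y, z) ↦ (x + t z, z, y + t² z)` of the plane, which preserves the hyperconic
in characteristic two. -/
def conicMove (t : F) : (Fin 3 → F) →ₗ[F] (Fin 3 → F) where
  toFun v := ![v 0 + t * v 2, v 2, v 1 + t ^ 2 * v 2]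
  map_add' v w := by
    ext i
    fin_cases i <;> simp <;> ring
  map_smul' c v := by
    ext i
    fin_cases i <;> simp <;> ring

theorem addLinked_maiorana_of_isAssociatedNihoBent (hK : Fintype.card K = Fintype.card F ^ 2)
    (hpol : ∀ x : K, ∃ (c : F) (u : unitCircle F K), x = algebraMap F K c * u)
    {f : K → ZMod 2} (hf : IsAssociatedNihoBent (hyperconic F) f) :
    AddLinked f (maiorana fun t : F => t ^ 2) ∨ AddLinked f (maiorana fun t : F => t⁻¹) := by
  have := charTwo F
  obtain ⟨-, g, hg, σ, φ, hφ, himg⟩ := hf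
  have hu : ∀ u : unitCircle F K, OnHyperconic (φ ((u : K), g u)) := by
    intro u
    have h : Projectivization.map φ hφ.injective (Projectivization.mk F ((u : K), g u)
        fun h => unitCircle_ne_zero u (Prod.ext_iff.1 h).1) ∈ hyperconic F :=
      himg ▸ Set.mem_image_of_mem _ (Or.inl ⟨u, rfl⟩)
    rwa [Projectivization.map_mk, mk_mem_hyperconic] at h
  have ho : OnHyperconic (φ (0, 1)) := by
    have h : Projectivization.map φ hφ.injective (origin F K) ∈ hyperconic F :=
      himg ▸ Set.mem_image_of_mem _ (Or.inr rfl)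
    rwa [origin, Projectivization.map_mk, mk_mem_hyperconic] at h
  by_cases h2 : φ (0, 1) 2 = 0
  · refine addLinked_maiorana_of_origin hK hg hpol φ hφ.injective hu h2 ?_
    rcases ho with ho | ho
    · left
      simpa [h2] using ho
    · exact Or.inr ho.1
  have ho' : φ (0, 1) 0 ^ 2 = φ (0, 1) 1 * φ (0, 1) 2 := by simpa [OnHyperconic, h2] using ho
  -- The origin maps to `(t : t² : 1)`, which `conicMove t` sends to `(0 : 1 : 0)`.
  let t := φ (0, 1) 0 / φ (0, 1) 2
  have hinj : Function.Injective (conicMove t) := by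
    rw [injective_iff_map_eq_zero]
    intro v hv
    have e0 : v 0 + t * v 2 = 0 := congrFun hv 0
    have e1 : v 2 = 0 := congrFun hv 1
    have e2 : v 1 + t ^ 2 * v 2 = 0 := congrFun hv 2
    ext i
    fin_cases i
    · simpa [e1] using e0
    · simpa [e1] using e2
    · exact e1
  have hQ : ∀ v, OnHyperconic v → OnHyperconic (conicMove t v) := by
    rintro v (hv | ⟨h1, h2⟩)
    · left
      change (v 0 + t * v 2) ^ 2 = v 2 * (v 1 + t ^ 2 * v 2)
      rw [CharTwo.add_sq, hv]
      ring
    · right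
      exact ⟨h2, by simp [conicMove, h1, h2]⟩
  refine addLinked_maiorana_of_origin hK hg hpol ((conicMove t).comp φ)
    (hinj.comp hφ.injective) (fun u => hQ _ (hu u)) ?_ (Or.inl ?_)
  · change φ (0, 1) 1 + t ^ 2 * φ (0, 1) 2 = 0
    rw [div_pow, ho', CharTwo.add_eq_zero]
    field_simp
  · change φ (0, 1) 0 + t * φ (0, 1) 2 = 0
    rw [CharTwo.add_eq_zero, div_mul_cancel₀ _ h2]

end Classification
-- The two representatives in coordinates.
section Representatives

variable {F K : Type*} [Field F] [Fintype F] [Field K] [Fintype K] [Algebra F K]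
  [Algebra (ZMod 2) F] [Algebra (ZMod 2) K]

theorem trace_eq_trace_trace (x : K) :
    Algebra.trace (ZMod 2) K x = Algebra.trace (ZMod 2) F (Algebra.trace F K x) := by
  have : IsScalarTower (ZMod 2) F K := IsScalarTower.of_algebraMap_eq' (Subsingleton.elim _ _)
  exact (Algebra.trace_trace x).symm

theorem addLinked_of_coordinates {E : (F × F) ≃ₗ[F] K} {f : K → ZMod 2} {ρ : F → F} {α β : F}
    (hf : ∀ p, f (E p) = maiorana ρ p + Algebra.trace (ZMod 2) F (α * p.1 + β * p.2)) :
    AddLinked f (maiorana ρ) := by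
  let l : F × F →+ ZMod 2 :=
    (Algebra.trace (ZMod 2) F).toAddMonoidHom.comp
      ((AddMonoidHom.mulLeft α).coprod (AddMonoidHom.mulLeft β))
  exact ⟨E.symm.toAddEquiv, l.comp E.symm.toAddEquiv.toAddMonoidHom,
    fun x => by simpa [l] using hf (E.symm x)⟩

section First

theorem trace_mul_algebraMap (hK : Fintype.card K = Fintype.card F ^ 2) {a : K}
    (ha : a + conj F a = 1) (n : F) :
    Algebra.trace (ZMod 2) K (a * algebraMap F K n) = Algebra.trace (ZMod 2) F n := by
  rw [trace_eq_trace_trace (F := F), mul_comm, trace_algebraMap_mul,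
    trace_eq_one_of_add_conj hK ha, mul_one]

theorem mul_conj_polar (c : F) (u : unitCircle F K) :
    (algebraMap F K c * u) * conj F (algebraMap F K c * (u : K)) = algebraMap F K (c ^ 2) := by
  have hu : (u : K) * conj F (u : K) = 1 := u.2
  rw [conj_mul, conj_algebraMap, map_pow]
  linear_combination algebraMap F K c ^ 2 * hu

theorem nihoF_one_eq {m : ℕ} (hF : Fintype.card F = 2 ^ m)
    (hK : Fintype.card K = Fintype.card F ^ 2) {a : K} (ha : a + conj F a = 1) {x : K} {n : F}
    (hn : x * conj F x = algebraMap F K n) :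
    nihoF m a 1 x = Algebra.trace (ZMod 2) F n := by
  have hx : x ^ (2 ^ m + 1) = algebraMap F K n := by
    rw [← hn, conj, hF, pow_succ, mul_comm]
  simp [nihoF, hx, trace_mul_algebraMap hK ha]

theorem isGivenBy_nihoF_one {m : ℕ} (hF : Fintype.card F = 2 ^ m)
    (hK : Fintype.card K = Fintype.card F ^ 2) {a : K} (ha : a + conj F a = 1) :
    IsGivenBy (nihoF m a 1) (gFirst F K) := by
  intro c u
  rw [nihoF_one_eq hF hK ha (mul_conj_polar c u), trace_sq, gFirst, mul_one]

/-- The norm is `s² + s t + δ² t²`, and the trace is invariant under squaring. -/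
theorem nihoF_one_coordinates {m : ℕ} (hF : Fintype.card F = 2 ^ m)
    (hK : Fintype.card K = Fintype.card F ^ 2) {a : K} (ha : a + conj F a = 1) {δ : F}
    (hδ : algebraMap F K (δ ^ 2) = a * conj F a) (p : F × F) :
    nihoF m a 1 (algebraMap F K p.1 + algebraMap F K p.2 * a) =
      maiorana (fun t => t ^ 2) p + Algebra.trace (ZMod 2) F (1 * p.1 + δ * p.2) := by
  rw [nihoF_one_eq hF hK ha (norm_coordinates hK ha hδ p.1 p.2), maiorana, ← mul_pow δ,
    ← mul_pow p.1]
  simp only [map_add, trace_sq, one_mul]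
  ring

/-- The coordinate change `((s, t), z) ↦ (z + s + δ t, s, t)`. -/
def nucleusEquiv (δ : F) : ((F × F) × F) ≃ₗ[F] (Fin 3 → F) where
  toFun v := ![v.2 + v.1.1 + δ * v.1.2, v.1.1, v.1.2]
  map_add' v w := by
    ext i
    fin_cases i <;> simp <;> ring
  map_smul' c v := by
    ext i
    fin_cases i <;> simp <;> ring
  invFun v := ((v 1, v 2), v 0 - v 1 - δ * v 2)
  left_inv v := by ext <;> simp <;> ring
  right_inv v := by
    ext i
    fin_cases i <;> simp <;> ring

/-- Here `c` is the square root of the norm, `s + δ t + √(s t)`, so the origin plays the role of the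
nucleus. -/
theorem projEquiv_gFirst (hK : Fintype.card K = Fintype.card F ^ 2) {a : K}
    (ha : a + conj F a = 1) {E : (F × F) ≃ₗ[F] K}
    (hE : ∀ p, E p = algebraMap F K p.1 + algebraMap F K p.2 * a) {δ : F}
    (hδ : algebraMap F K (δ ^ 2) = a * conj F a) :
    ProjEquiv (hyperoval (gFirst F K)) (hyperconic F) := by
  have := charTwo F
  choose r hr using exists_sq_eq (F := F)
  refine projEquiv_hyperoval_hyperconic E (exists_polar hK ha)
    (h := fun p => p.1 + δ * p.2 + r (p.1 * p.2)) ?_ (nucleusEquiv δ) ?_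
  · rintro c u ⟨s, t⟩ h
    apply sq_injective
    apply (algebraMap F K).injective
    have hc := mul_conj_polar c u
    rw [← h, hE, norm_coordinates hK ha hδ] at hc
    simp only [gFirst, mul_one, CharTwo.add_sq, hr]
    rw [← hc]
    congr 1
    ring
  · rintro ⟨s, t⟩ z
    change (z + s + δ * t) ^ 2 = s * t ∨ s = 0 ∧ t = 0 ↔ _
    have hz : z = s + δ * t + r (s * t) ↔ z + s + δ * t = r (s * t) :=
      ⟨fun h => by linear_combination h + (s + δ * t) * CharTwo.two_eq_zero (R := F),
        fun h => by linear_combination h - (s + δ * t) * CharTwo.two_eq_zero (R := F)⟩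
    rw [Prod.mk_eq_zero, or_comm, hz]
    refine or_congr_right ?_
    conv_lhs => rw [← hr (s * t)]
    exact sq_injective.eq_iff

end First

section Last

/-- With `q = Q + 1` the exponent is `q(q - 1)·2i + q²`. On `F*` it acts as `1`; on `S`, where `u^q
= u⁻¹`, it acts as `4i + 1`. -/
theorem pow_nihoExponent {k : ℕ} (hF : Fintype.card F = 2 ^ (k + 2)) (c : F)
    (u : unitCircle F K) (i : ℕ) :
    (algebraMap F K c * (u : K)) ^ nihoExponent (k + 2) (k + 1) i =
      algebraMap F K c * (u : K) ^ (4 * i + 1) := by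
  obtain ⟨Q, hQ⟩ : ∃ Q, 2 ^ (k + 2) = Q + 1 := ⟨2 ^ (k + 2) - 1, by
    have := Nat.one_le_two_pow (n := k + 2); omega⟩
  have hexp : nihoExponent (k + 2) (k + 1) i = Q * ((Q + 1) * (2 * i)) + (Q + 1) * (Q + 1) := by
    have h1 : 2 * (k + 2) - (k + 1) = k + 2 + 1 := by omega
    have h2 : 2 ^ (k + 2) = 2 * 2 ^ (k + 1) := by ring
    rw [nihoExponent, h1, pow_succ 2 (k + 2), hQ, Nat.add_sub_cancel]
    have h3 : 2 * 2 ^ (k + 1) = Q + 1 := by rw [← h2, hQ]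
    linear_combination (Q + 1) * h3
  rw [hexp]
  have hu : (u : K) * (u : K) ^ (Q + 1) = 1 := by
    have : (u : K) * conj F (u : K) = 1 := u.2
    rwa [conj, hF, hQ] at this
  have hu0 := unitCircle_ne_zero u
  have hu1 : (u : K) ^ (Q + 1) = (u : K)⁻¹ := eq_inv_of_mul_eq_one_right hu
  have hu2 : (u : K) ^ Q = ((u : K) ^ 2)⁻¹ := by
    rw [pow_succ] at hu
    apply eq_inv_of_mul_eq_one_right
    linear_combination hu
  by_cases hc : c = 0
  · simp [hc]
  have hc1 : c ^ (Q + 1) = c := by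
    rw [← hQ, ← hF]
    exact FiniteField.pow_card c
  have hc2 : c ^ Q = 1 := by
    rw [pow_succ] at hc1
    exact mul_right_cancel₀ hc (by rw [hc1, one_mul])
  have hcK : algebraMap F K c ^ (Q * ((Q + 1) * (2 * i)) + (Q + 1) * (Q + 1)) =
      algebraMap F K c := by
    rw [← map_pow, pow_add, pow_mul, hc2, one_pow, one_mul, pow_mul, hc1, hc1]
  have e1 : (u : K) ^ (Q * ((Q + 1) * (2 * i))) = (u : K) ^ (4 * i) := by
    rw [mul_left_comm, pow_mul, hu1, pow_mul, inv_pow, hu2, inv_inv, ← pow_mul, ← mul_assoc]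
    rfl
  have e2 : (u : K) ^ ((Q + 1) * (Q + 1)) = u := by
    rw [pow_mul, hu1, inv_pow, hu1, inv_inv]
  rw [mul_pow, hcK, pow_add, e1, e2, pow_succ]

theorem trace_unitCircle_ne_zero (hK : Fintype.card K = Fintype.card F ^ 2)
    {u : unitCircle F K} (hu1 : (u : K) ≠ 1) : Algebra.trace F K (u : K) ≠ 0 := by
  have := charTwo K
  intro h
  have h2 := algebraMap_trace_eq hK (u : K)
  rw [h, map_zero] at h2
  have h3 : (u : K) = conj F (u : K) := CharTwo.add_eq_zero.1 h2.symm
  have hu : (u : K) * conj F (u : K) = 1 := u.2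
  rw [← h3] at hu
  exact hu1 (sq_injective (by simpa [sq] using hu))

/-- Adding the term `i = 0` gives a geometric series with sum `A = (v + 1)⁻³`. Then `T(A) = (1 + v +
v²)/(1 + v)²`, which is `1 + 1/T(v)` because `(v + 1)² = v T(v)`. -/
theorem one_add_trace_sum (hK : Fintype.card K = Fintype.card F ^ 2) {k : ℕ}
    (hF : Fintype.card F = 2 ^ (k + 2)) (u : unitCircle F K) :
    1 + Algebra.trace F K (∑ i ∈ Finset.Icc 1 (2 ^ k - 1), (u : K) ^ (4 * i + 1)) =
      gLast F K u := by
  have := charTwo K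
  have := charTwo F
  rw [gLast]
  split_ifs with hu1
  · have h : ∑ i ∈ Finset.Icc 1 (2 ^ k - 1), (u : K) ^ (4 * i + 1) =
        algebraMap F K (2 ^ k - 1 : ℕ) := by
      rw [map_natCast]
      simp [hu1]
    rw [h, trace_algebraMap_eq_zero hK, add_zero]
  have hu : (u : K) * conj F (u : K) = 1 := u.2
  have hu0 := unitCircle_ne_zero u
  have hT := trace_unitCircle_ne_zero hK hu1
  set v : K := (u : K) with hv
  have hTv := algebraMap_trace_eq (F := F) hK v
  have hsum : ∑ i ∈ Finset.range (2 ^ k), v ^ (4 * i + 1) =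
      v + ∑ i ∈ Finset.Icc 1 (2 ^ k - 1), v ^ (4 * i + 1) := by
    have h1 : 2 ^ k = (2 ^ k - 1) + 1 := by have := Nat.one_le_two_pow (n := k); omega
    conv_lhs => rw [h1]
    rw [Finset.range_eq_Ico, Finset.sum_eq_sum_Ico_succ_bot (by omega)]
    simp only [mul_zero, zero_add, pow_one]
    rfl
  set A := ∑ i ∈ Finset.range (2 ^ k), v ^ (4 * i + 1) with hA
  have hv1 : v + 1 ≠ 0 := fun h => hu1 (CharTwo.add_eq_zero.1 h)
  have hgeom : A * (v + 1) ^ 3 = 1 := by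
    have h1 : A = v * ∑ i ∈ Finset.range (2 ^ k), (v ^ 4) ^ i := by
      rw [hA, Finset.mul_sum]
      refine Finset.sum_congr rfl fun i _ => ?_
      rw [← pow_mul, pow_succ, mul_comm]
    have h2 := geom_sum_mul (v ^ 4) (2 ^ k)
    -- The series has `2^k = q / 4` terms, so its last power is `v^q`.
    have h3 : (v ^ 4) ^ 2 ^ k = conj F v := by
      rw [conj, hF, ← pow_mul]
      congr 1
      ring
    rw [h3] at h2
    apply mul_right_cancel₀ hv1
    rw [h1]
    have h4 : (v + 1) ^ 3 * (v + 1) = v ^ 4 - 1 := by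
      linear_combination (2 * v ^ 3 + 3 * v ^ 2 + 2 * v + 1) * CharTwo.two_eq_zero (R := K)
    rw [mul_assoc, h4, mul_assoc, h2]
    linear_combination hu - v * CharTwo.two_eq_zero (R := K)
  have hgeom' : conj F A * (v + 1) ^ 3 = v ^ 3 := by
    have h1 := congrArg (conj F) hgeom
    have h1' : conj F (1 : K) = 1 := by simp [conj]
    have h2 : conj F ((v + 1) ^ 3) = (conj F v + 1) ^ 3 := by
      rw [← h1', ← conj_add hK, h1', conj, conj, ← pow_mul, ← pow_mul, mul_comm]
    rw [conj_mul, h2, h1'] at h1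
    have h3 : (conj F v + 1) * v = v + 1 := by linear_combination hu
    rw [← h3]
    linear_combination v ^ 3 * h1
  have hTA : Algebra.trace F K A * Algebra.trace F K v = Algebra.trace F K v + 1 := by
    apply (algebraMap F K).injective
    rw [map_mul, map_add, map_one]
    have e1 : algebraMap F K (Algebra.trace F K v) * v = (v + 1) ^ 2 := by
      rw [hTv]
      linear_combination hu - v * CharTwo.two_eq_zero (R := K)
    have e2 : algebraMap F K (Algebra.trace F K A) * (v + 1) ^ 2 = 1 + v + v ^ 2 := by
      apply mul_right_cancel₀ hv1
      rw [algebraMap_trace_eq hK]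
      linear_combination hgeom + hgeom' - (v + v ^ 2) * CharTwo.two_eq_zero (R := K)
    apply mul_right_cancel₀ hu0
    linear_combination (algebraMap F K (Algebra.trace F K A) - 1) * e1 + e2
      - v * CharTwo.two_eq_zero (R := K)
  have hfin := congrArg (Algebra.trace F K) hsum
  rw [map_add] at hfin
  rw [hfin] at hTA
  apply mul_right_cancel₀ hT
  linear_combination hTA - div_mul_cancel₀ (1 : F) hT
    + (Algebra.trace F K v - Algebra.trace F K v ^ 2) * CharTwo.two_eq_zero (R := F)

theorem isGivenBy_nihoF_last {k : ℕ} (hF : Fintype.card F = 2 ^ (k + 2))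
    (hK : Fintype.card K = Fintype.card F ^ 2) {a : K} (ha : a + conj F a = 1) :
    IsGivenBy (nihoF (k + 2) a (k + 1)) (gLast F K) := by
  intro c u
  have h1 := isGivenBy_nihoF_one hF hK ha c u
  simp only [nihoF, Nat.sub_self, pow_zero, Nat.sub_self, Finset.Icc_eq_empty_of_lt,
    zero_lt_one, Finset.sum_empty, add_zero, gFirst] at h1
  rw [nihoF, map_add, h1, Nat.add_sub_cancel, Finset.sum_congr rfl
    fun i _ => pow_nihoExponent hF c u i, ← Finset.mul_sum, trace_eq_trace_trace (F := F) (K := K),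
    trace_algebraMap_mul (F := F) (K := K), ← map_add, ← mul_add, one_add_trace_sum hK hF]

/-- From `t = c T(u)` one gets `c (1/T(u) + T(u)) = c²/t + t`, and `c²` is the norm `s² + s t + δ
t²`. For `u = 1` one has `t = 0` and `c = s`, consistent with `0⁻¹ = 0`. -/
theorem mul_gLast_coordinates (hK : Fintype.card K = Fintype.card F ^ 2) {a : K}
    (ha : a + conj F a = 1) {δ : F} (hδ : algebraMap F K δ = a * conj F a) {c : F}
    {u : unitCircle F K} {s t : F}
    (h : algebraMap F K s + algebraMap F K t * a = algebraMap F K c * u) :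
    c * gLast F K u = s ^ 2 * t⁻¹ + s + (δ + 1) * t := by
  have hc := mul_conj_polar c u
  rw [← h, norm_coordinates hK ha hδ] at hc
  replace hc := (algebraMap F K).injective hc
  have ht := congrArg (Algebra.trace F K) h
  rw [trace_coordinates hK ha, trace_algebraMap_mul] at ht
  rw [gLast]
  split_ifs with hu1
  · rw [hu1, ← map_one (algebraMap F K), trace_algebraMap_eq_zero hK, mul_zero] at ht
    subst ht
    rw [hu1, map_zero, zero_mul, add_zero, mul_one] at h
    simp [(algebraMap F K).injective h]
  · have hT := trace_unitCircle_ne_zero hK hu1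
    by_cases hc0 : c = 0
    · subst hc0
      rw [zero_mul] at ht
      subst ht
      simp at hc
      simp [hc]
    · have ht0 : t ≠ 0 := ht ▸ mul_ne_zero hc0 hT
      have hTt : Algebra.trace F K (u : K) = t / c := by
        rw [ht]
        field_simp
      rw [hTt]
      field_simp
      linear_combination -hc

/-- The coordinate change `((s, t), z) ↦ (s, z + s + ε t, t)`. -/
def conicEquiv (ε : F) : ((F × F) × F) ≃ₗ[F] (Fin 3 → F) where
  toFun v := ![v.1.1, v.2 + v.1.1 + ε * v.1.2, v.1.2]
  map_add' v w := by
    ext i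
    fin_cases i <;> simp <;> ring
  map_smul' c v := by
    ext i
    fin_cases i <;> simp <;> ring
  invFun v := ((v 0, v 2), v 1 - v 0 - ε * v 2)
  left_inv v := by ext <;> simp <;> ring
  right_inv v := by
    ext i
    fin_cases i <;> simp <;> ring

theorem projEquiv_gLast (hK : Fintype.card K = Fintype.card F ^ 2) {a : K}
    (ha : a + conj F a = 1) {E : (F × F) ≃ₗ[F] K}
    (hE : ∀ p, E p = algebraMap F K p.1 + algebraMap F K p.2 * a) {δ : F}
    (hδ : algebraMap F K δ = a * conj F a) :
    ProjEquiv (hyperoval (gLast F K)) (hyperconic F) := by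
  have := charTwo F
  refine projEquiv_hyperoval_hyperconic E (exists_polar hK ha)
    (h := fun p => p.1 ^ 2 * p.2⁻¹ + p.1 + (δ + 1) * p.2) ?_ (conicEquiv (δ + 1)) ?_
  · intro c u p h
    rw [hE] at h
    exact mul_gLast_coordinates hK ha hδ h
  · rintro ⟨s, t⟩ z
    change s ^ 2 = (z + s + (δ + 1) * t) * t ∨ z + s + (δ + 1) * t = 0 ∧ t = 0 ↔ _
    have hz : z = s ^ 2 * t⁻¹ + s + (δ + 1) * t ↔ z + s + (δ + 1) * t = s ^ 2 * t⁻¹ :=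
      ⟨fun h => by linear_combination h + (s + (δ + 1) * t) * CharTwo.two_eq_zero (R := F),
        fun h => by linear_combination h - (s + (δ + 1) * t) * CharTwo.two_eq_zero (R := F)⟩
    rw [Prod.mk_eq_zero, hz]
    generalize z + s + (δ + 1) * t = y
    by_cases ht : t = 0
    · simp [ht]
    · simp only [ht, and_false, or_false, false_or]
      rw [← div_eq_mul_inv, eq_div_iff ht, eq_comm]

end Last

end Representatives

end Niho

theorem mainTheorem1 (m : ℕ) (hm : 3 ≤ m) (F K : Type*) [Field F] [Fintype F] [Field K] [Fintype K]
    [Algebra F K] [Algebra (ZMod 2) F] [Algebra (ZMod 2) K]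
    (hF : Fintype.card F = 2 ^ m) (hK : Fintype.card K = 2 ^ (2 * m))
    (a : K) (ha : a + Niho.conj F a = 1) :
    Nat.card (Quotient (Niho.nihoSetoid K (Niho.hyperconic F))) = 2 ∧
    (∃ (h1 : Niho.IsAssociatedNihoBent (Niho.hyperconic F) (Niho.nihoF m a 1))
        (h2 : Niho.IsAssociatedNihoBent (Niho.hyperconic F) (Niho.nihoF m a (m - 1))),
      ∀ c : Quotient (Niho.nihoSetoid K (Niho.hyperconic F)),
        c = Quotient.mk _ ⟨Niho.nihoF m a 1, h1⟩ ∨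
        c = Quotient.mk _ ⟨Niho.nihoF m a (m - 1), h2⟩) ∧
    Niho.IsGivenBy (Niho.nihoF m a 1) (Niho.gFirst F K) ∧
    Niho.IsGivenBy (Niho.nihoF m a (m - 1)) (Niho.gLast F K) := by
  have := Niho.charTwo F
  have hK' : Fintype.card K = Fintype.card F ^ 2 := by
    rw [hK, hF, ← pow_mul, mul_comm]
  have h4 : 4 < Fintype.card F := by
    rw [hF]
    calc 4 < 2 ^ 3 := by norm_num
      _ ≤ 2 ^ m := Nat.pow_le_pow_right two_pos hm
  have hpol := Niho.exists_polar (F := F) hK' ha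
  obtain ⟨E, hE⟩ := Niho.exists_coordinates (F := F) hK' ha
  obtain ⟨ε, hε⟩ := Niho.exists_algebraMap_eq_mul_conj (F := F) hK' ha a
  -- The norm of `a` is written as `δ²`, since the linear term of `f_1` involves its square root.
  obtain ⟨δ, rfl⟩ := Niho.exists_sq_eq ε
  have g1 : Niho.IsGivenBy (Niho.nihoF m a 1) (Niho.gFirst F K) :=
    Niho.isGivenBy_nihoF_one hF hK' ha
  have g2 : Niho.IsGivenBy (Niho.nihoF m a (m - 1)) (Niho.gLast F K) := by
    obtain ⟨k, rfl⟩ : ∃ k, m = k + 2 := ⟨m - 2, by omega⟩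
    exact Niho.isGivenBy_nihoF_last hF hK' ha
  have c1 : ∀ p, Niho.nihoF m a 1 (E p) = Niho.maiorana (fun t => t ^ 2) p
      + Algebra.trace (ZMod 2) F (1 * p.1 + δ * p.2) := by
    intro p
    rw [hE]
    exact Niho.nihoF_one_coordinates hF hK' ha hε p
  have c2 : ∀ p, Niho.nihoF m a (m - 1) (E p) = Niho.maiorana (fun t => t⁻¹) p
      + Algebra.trace (ZMod 2) F (1 * p.1 + (δ ^ 2 + 1) * p.2) := by
    intro p
    obtain ⟨c, u, h⟩ := hpol (E p)
    rw [h, g2, Niho.mul_gLast_coordinates hK' ha hε ((hE p).symm.trans h), Niho.maiorana,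
      ← map_add, one_mul, add_assoc]
  have hadd := Niho.conj_add (F := F) hK'
  have h1 : Niho.IsAssociatedNihoBent (Niho.hyperconic F) (Niho.nihoF m a 1) :=
    ⟨Niho.isNihoBent_of_isGivenBy (Niho.isBent_of_maiorana
      (Function.Injective.bijective_of_finite Niho.sq_injective) _ _ c1 hadd) g1,
      _, g1, Niho.projEquiv_gFirst hK' ha hE hε⟩
  have h2 : Niho.IsAssociatedNihoBent (Niho.hyperconic F) (Niho.nihoF m a (m - 1)) :=
    ⟨Niho.isNihoBent_of_isGivenBy (Niho.isBent_of_maiorana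
      (Function.Injective.bijective_of_finite inv_injective) _ _ c2 hadd) g2,
      _, g2, Niho.projEquiv_gLast hK' ha hE hε⟩
  have l1 := Niho.addLinked_of_coordinates c1
  have l2 := Niho.addLinked_of_coordinates c2
  have hall : ∀ c : Quotient (Niho.nihoSetoid K (Niho.hyperconic F)),
      c = Quotient.mk _ ⟨Niho.nihoF m a 1, h1⟩ ∨
      c = Quotient.mk _ ⟨Niho.nihoF m a (m - 1), h2⟩ := by
    intro c
    induction c using Quotient.inductionOn with
    | h f =>
      rcases Niho.addLinked_maiorana_of_isAssociatedNihoBent hK' hpol f.2 with h | h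
      · exact Or.inl (Quotient.sound (h.trans l1.symm).eaEquiv)
      · exact Or.inr (Quotient.sound (h.trans l2.symm).eaEquiv)
  have hne : (Quotient.mk (Niho.nihoSetoid K (Niho.hyperconic F)) ⟨Niho.nihoF m a 1, h1⟩) ≠
      Quotient.mk _ ⟨Niho.nihoF m a (m - 1), h2⟩ := by
    intro h
    have hea : Niho.EAEquiv (Niho.nihoF m a 1) (Niho.nihoF m a (m - 1)) := Quotient.exact h
    exact Niho.not_isQuadratic_maiorana_inv h4 (l2.symm.isQuadratic
      (hea.isQuadratic (l1.isQuadratic Niho.isQuadratic_maiorana_sq)))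
  refine ⟨Nat.card_eq_two_iff.2 ⟨_, _, hne, ?_⟩, ⟨h1, h2, hall⟩, g1, g2⟩
  ext c
  simpa using hall c
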